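/- Let $F\subset\mathbb R^{d}$ be a self-similar fractal, i.e. a nonempty compact set with $F=\bigcup_{i\in I} w_iF$, where $I$ is finite and each $w_i:\mathbb R^d\to\mathbb R^d$ is a contracting similarity: $|w_i(a)-w_i(b)|=r_i|a-b|$ for all $a,b$, with some $r_i\in(0,1)$. Let $w=w_i$ be one of the generating similarities and let $x=w(x)$ be its fixed point (which belongs to $F$). Put $$Z=\overline{\bigcup_{n\in\mathbb N}w^{-n}F}\subset\mathbb R^d .$$ For pointed metric spaces $(X,x)$, $(Y,y)$ and $R>0$ let $d^{R}((X,x),(Y,y))$ be the infimum of the $\varepsilon>0$ for which there are isometric embeddings $\varphi_X,\varphi_Y$ of $X,Y$ into some metric space such that $\varphi_X(x)$ and $\varphi_Y(y)$ have distance less than $\varepsilon$, $\varphi_X(\overline B_X(x,R))$ is contained in the open $\varepsilon$-neighbourhood of $\varphi_Y(Y)$, and $\varphi_Y(\overline B_Y(y,R))$ is contained in the open $\varepsilon$-neighbourhood of $\varphi_X(X)$. The sets $V^{R,\varepsilon}(X,x)=\{(Y,y): d^{R}((X,x),(Y,y))<\varepsilon\}$, $R>0$, $\varepsilon\in(0,1)$,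 form a neighbourhood base of $(X,x)$ in the pointed Gromov-Hausdorff topology. The tangent cone $\mathcal T_xF$ is the family of all proper pointed metric spaces $(T,p)$ that are limit points, for $t\to\infty$, of the rescaled spaces $(F,x,t\,|\cdot|)$ in this topology; that is, for all $R>0$, $\varepsilon\in(0,1)$ and $t_0$ there is $t>t_0$, $t>0$, with $(F,x,t\,|\cdot|)\in V^{R,\varepsilon}(T,p)$. Then $\mathcal T_xF$ consists exactly of all dilations of $Z$: a pointed metric space $(T,p)$ belongs to $\mathcal T_xF$ if and only if, for some $c>0$, it is isometric, as a pointed metric space, to $(Z,x,c\,|\cdot|)$. -/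

import Mathlib

universe u v

/-- A pointed metric space `(X, x)`. -/
structure PointedMetricSpace : Type (u + 1) where
  carrier : Type u
  [metric : MetricSpace carrier]
  base : carrier

namespace PointedMetricSpace

instance : CoeSort PointedMetricSpace.{u} (Type u) := ⟨carrier⟩

instance (X : PointedMetricSpace.{u}) : MetricSpace X := X.metric

/-- The subset `S` of a metric space `E`, with the restricted distance, pointed at `x ∈ S`. -/
def ofSubset {E : Type u} [MetricSpace E] (S : Set E) (x : E) (hx : x ∈ S) :
    PointedMetricSpace.{u} where
  carrier := S
  base := ⟨x, hx⟩

/-- The dilation `(X, x, t d)` of the pointed metric space `(X, x, d)`, for `t > 0`. -/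
def rescale (X : PointedMetricSpace.{u}) (t : ℝ) (ht : 0 < t) : PointedMetricSpace.{u} where
  carrier := X.carrier
  metric :=
    { dist := fun a b => t * dist a b
      dist_self := fun a => by simp
      dist_comm := fun a b => by simp [dist_comm]
      dist_triangle := fun a b c => by
        rw [← mul_add]
        exact mul_le_mul_of_nonneg_left (dist_triangle a b c) ht.le
      eq_of_dist_eq_zero := fun {a b} h =>
        dist_eq_zero.mp ((mul_eq_zero.mp h).resolve_left ht.ne') }
  base := X.base

/-- Isometry of pointed metric spaces: a surjective isometry preserving the base points. -/
def IsIsometricTo (X : PointedMetricSpace.{u}) (Y : PointedMetricSpace.{v}) : Prop :=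
  ∃ e : X ≃ᵢ Y, e X.base = Y.base

/-- There are isometric embeddings `φ`, `ψ` of `X`, `Y` into a common metric space such that the
base points are at distance `< ε`, and each of the closed balls of radius `R` about the base points
is contained in the `ε`-neighbourhood of the other space. -/
def AreClose (R ε : ℝ) (X : PointedMetricSpace.{u}) (Y : PointedMetricSpace.{v}) : Prop :=
  ∃ (Z : Type (max u v)) (_ : MetricSpace Z) (φ : X → Z) (ψ : Y → Z),
    Isometry φ ∧ Isometry ψ ∧ dist (φ X.base) (ψ Y.base) < ε ∧
    φ '' Metric.closedBall X.base R ⊆ Metric.thickening ε (Set.range ψ) ∧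
    ψ '' Metric.closedBall Y.base R ⊆ Metric.thickening ε (Set.range φ)

/-- The quantity `d^R((X, x), (Y, y))`. -/
noncomputable def ghDistAt (R : ℝ) (X : PointedMetricSpace.{u}) (Y : PointedMetricSpace.{v}) : ℝ :=
  sInf {ε : ℝ | 0 < ε ∧ AreClose R ε X Y}

/-- The basic neighbourhood `V^{R,ε}(X, x)` in the pointed Gromov-Hausdorff topology. -/
def basicNhd (R ε : ℝ) (X : PointedMetricSpace.{u}) : Set PointedMetricSpace.{v} :=
  {Y | ghDistAt R X Y < ε}

/-- The tangent cone of `X` at its base point: the family of all proper pointed metric spaces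
that are limit points, for `t → ∞`, of the dilations `(X, x, t d)` in the pointed Gromov-Hausdorff
topology, i.e. every basic neighbourhood contains dilations with arbitrarily large parameter. -/
def tangentCone (X : PointedMetricSpace.{v}) : Set PointedMetricSpace.{u} :=
  {T | ProperSpace T ∧ ∀ R : ℝ, 0 < R → ∀ ε ∈ Set.Ioo (0 : ℝ) 1, ∀ t₀ : ℝ,
    ∃ (t : ℝ) (ht : 0 < t), t₀ < t ∧ X.rescale t ht ∈ basicNhd R ε T}

end PointedMetricSpace

/-- A contracting similarity: all distances are multiplied by a fixed ratio in `(0, 1)`. -/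
def IsContractingSimilarity {E : Type u} [MetricSpace E] (f : E → E) : Prop :=
  ∃ r ∈ Set.Ioo (0 : ℝ) 1, ∀ a b, dist (f a) (f b) = r * dist a b

/-- `F` is the self-similar fractal generated by the family `w` of contracting similarities:
the nonempty compact set which is the union of its images under the `w i`. -/
structure IsSelfSimilarFractal {E : Type u} [MetricSpace E] {ι : Type v} (w : ι → E → E)
    (F : Set E) : Prop where
  similarity : ∀ i, IsContractingSimilarity (w i)
  nonempty : F.Nonempty
  isCompact : IsCompact F
  eq_iUnion : F = ⋃ i, w i '' F

/-- The closure of the union of the sets `f⁻ⁿ F`, `n ∈ ℕ`. -/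
def blowUp {E : Type u} [MetricSpace E] (f : E → E) (F : Set E) : Set E :=
  closure (⋃ n : ℕ, f^[n] ⁻¹' F)

/-- The fixed point of a generating similarity belongs to the fractal. -/
theorem IsSelfSimilarFractal.mem_of_isFixedPt {E : Type u} [MetricSpace E] {ι : Type v}
    {w : ι → E → E} {F : Set E} (hF : IsSelfSimilarFractal w F) {i : ι} {x : E}
    (hx : w i x = x) : x ∈ F := by
  obtain ⟨y, hy⟩ := hF.nonempty
  obtain ⟨r, hr, hw⟩ := hF.similarity i
  have hmaps : ∀ z ∈ F, w i z ∈ F := fun z hz => by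
    rw [hF.eq_iUnion]
    exact Set.mem_iUnion.mpr ⟨i, z, hz, rfl⟩
  have hmem : ∀ n : ℕ, (w i)^[n] y ∈ F := fun n => by
    induction n with
    | zero => exact hy
    | succ n ih =>
      rw [Function.iterate_succ_apply']
      exact hmaps _ ih
  have hdist : ∀ n : ℕ, dist ((w i)^[n] y) x = r ^ n * dist y x := fun n => by
    induction n with
    | zero => simp
    | succ n ih =>
      rw [Function.iterate_succ_apply']
      nth_rewrite 1 [← hx]
      rw [hw, ih, pow_succ]
      ring
  have hlim : Filter.Tendsto (fun n : ℕ => (w i)^[n] y) Filter.atTop (nhds x) := by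
    rw [tendsto_iff_dist_tendsto_zero]
    simp only [hdist]
    simpa using (tendsto_pow_atTop_nhds_zero_of_lt_one hr.1.le hr.2).mul_const (dist y x)
  exact hF.isCompact.isClosed.mem_of_tendsto hlim (Filter.Eventually.of_forall hmem)

/-- A point of `F` belongs to the blow-up of `F`. -/
theorem mem_blowUp {E : Type u} [MetricSpace E] {f : E → E} {F : Set E} {x : E} (hx : x ∈ F) :
    x ∈ blowUp f F :=
  subset_closure (Set.mem_iUnion.mpr ⟨0, hx⟩)

/-!
Put `f = w i` and let `r` be its ratio. The preimages `f⁻ⁿ F` increase with `n`, and `f⁻ⁿ F` is the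
dilation of `F` by `r⁻ⁿ` about `x`, up to isometry. By compactness, on every ball about `x` they
approximate `Z = blowUp f F` uniformly (`exists_forall_blowUp_approx`).

Consequently the dilations of `F` by `c r⁻ⁿ` converge to `(Z, x, c |·|)`, which is proper; this
puts every dilation of `Z` into the tangent cone (`mem_tangentCone_of_isIsometricTo`).

Conversely, let `T` be a limit point. A dilation factor `t ≥ 1` is `s r⁻ⁿ` with `s ∈ [1, r⁻¹]`, so
closeness of `T` to the dilations of `F` by arbitrarily large `t` provides relations `rel k`
between `T` and `Z` which are total in both directions on larger and larger balls and which
distort the distances of `T` and of `(Z, s k |·|)` by an amount tending to `0`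
(`exists_approx_rel`). Along an ultrafilter, the factors `s k` converge to some `c ∈ [1, r⁻¹]`, and
by properness related points converge as well. The limit is an isometry from `T` onto
`(Z, x, c |·|)` (`exists_equiv_of_tendsto_rel`).
-/

open Filter Topology

/-! ### Ultralimits of approximate dilations between proper spaces -/

/-- In a proper space, a bounded sequence converges along every ultrafilter. -/
theorem Ultrafilter.exists_tendsto_of_bounded {α X : Type*} [MetricSpace X] [ProperSpace X]
    (U : Ultrafilter α) (u : α → X) (x : X) (M : ℝ) (h : ∀ᶠ k in U, dist (u k) x ≤ M) :
    ∃ a, Tendsto u U (𝓝 a) := by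
  obtain ⟨a, -, ha⟩ := (isCompact_closedBall x M).ultrafilter_le_nhds (U.map u)
    (Filter.le_principal_iff.mpr h)
  exact ⟨a, ha⟩

/-- Two proper pointed metric spaces that are related by relations `rel k`, each point being
eventually related to some point on the other side, such that `rel k` multiplies distances
by `1 / s k` up to an error tending to `0`, are dilations of each other. -/
theorem exists_equiv_of_tendsto_rel {X Y : Type*} [MetricSpace X] [MetricSpace Y] [ProperSpace X]
    [ProperSpace Y] {x : X} {y : Y} (U : Ultrafilter ℕ) {s ε : ℕ → ℝ} {c : ℝ} (hc : 0 < c)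
    (hs : Tendsto s U (𝓝 c)) (hε : Tendsto ε U (𝓝 0)) (rel : ℕ → X → Y → Prop)
    (hbase : ∀ k, rel k x y) (hX : ∀ a, ∀ᶠ k in U, ∃ b, rel k a b)
    (hY : ∀ b, ∀ᶠ k in U, ∃ a, rel k a b)
    (hdist : ∀ k a b a' b', rel k a b → rel k a' b' →
      |dist a a' - s k * dist b b'| ≤ ε k) :
    ∃ e : X ≃ Y, e x = y ∧ ∀ a a', dist a a' = c * dist (e a) (e a') := by
  have key : ∀ (a a' : ℕ → X) (b b' : ℕ → Y) (p p' : X) (q q' : Y), Tendsto a U (𝓝 p) →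
      Tendsto a' U (𝓝 p') → Tendsto b U (𝓝 q) → Tendsto b' U (𝓝 q') →
      (∀ᶠ k in U, rel k (a k) (b k)) → (∀ᶠ k in U, rel k (a' k) (b' k)) →
      dist p p' = c * dist q q' := by
    intro a a' b b' p p' q q' ha ha' hb hb' h h'
    have hlim := ((ha.dist ha').sub (hs.mul (hb.dist hb'))).abs
    have hle := le_of_tendsto_of_tendsto hlim hε
      ((h.and h').mono fun k hk => hdist k _ _ _ _ hk.1 hk.2)
    exact sub_eq_zero.mp (abs_nonpos_iff.mp hle)
  have hf : ∀ k a, ∃ b, (∃ b', rel k a b') → rel k a b := fun k a => by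
    by_cases h : ∃ b', rel k a b'
    · exact ⟨h.choose, fun _ => h.choose_spec⟩
    · exact ⟨y, fun h' => absurd h' h⟩
  have hg : ∀ k b, ∃ a, (∃ a', rel k a' b) → rel k a b := fun k b => by
    by_cases h : ∃ a', rel k a' b
    · exact ⟨h.choose, fun _ => h.choose_spec⟩
    · exact ⟨x, fun h' => absurd h' h⟩
  choose f hf using hf
  choose g hg using hg
  have hfrel : ∀ a, ∀ᶠ k in U, rel k a (f k a) := fun a => (hX a).mono fun k => hf k a
  have hgrel : ∀ b, ∀ᶠ k in U, rel k (g k b) b := fun b => (hY b).mono fun k => hg k b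
  have hε1 : ∀ᶠ k in U, ε k < 1 := hε.eventually_lt_const one_pos
  have hs1 : ∀ᶠ k in U, c / 2 < s k := hs.eventually_const_lt (half_lt_self hc)
  have hs2 : ∀ᶠ k in U, s k < c + 1 := hs.eventually_lt_const (lt_add_one c)
  have hfl : ∀ a, ∃ b, Tendsto (fun k => f k a) U (𝓝 b) := fun a => by
    refine U.exists_tendsto_of_bounded _ y ((dist a x + 1) / (c / 2)) ?_
    filter_upwards [hfrel a, hε1, hs1] with k h1 h2 h3
    have h4 := (abs_le.mp (hdist k _ _ _ _ h1 (hbase k))).1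
    rw [le_div_iff₀ (by positivity)]
    nlinarith [dist_nonneg (x := f k a) (y := y)]
  have hgl : ∀ b, ∃ a, Tendsto (fun k => g k b) U (𝓝 a) := fun b => by
    refine U.exists_tendsto_of_bounded _ x ((c + 1) * dist b y + 1) ?_
    filter_upwards [hgrel b, hε1, hs2] with k h1 h2 h3
    have h4 := (abs_le.mp (hdist k _ _ _ _ h1 (hbase k))).2
    nlinarith [dist_nonneg (x := b) (y := y)]
  choose e he using hfl
  choose e' he' using hgl
  have hb : ∀ᶠ k in U, rel k x y := Eventually.of_forall hbase
  have hd : ∀ a a', dist a a' = c * dist (e a) (e a') := fun a a' =>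
    key _ _ _ _ _ _ _ _ tendsto_const_nhds tendsto_const_nhds (he a) (he a') (hfrel a) (hfrel a')
  have hinj : Function.Injective e := fun a a' h => by
    rw [← dist_eq_zero, hd, h, dist_self, mul_zero]
  have hsurj : Function.Surjective e := fun b => by
    have h := key _ _ _ _ _ _ _ _ (he' b) tendsto_const_nhds tendsto_const_nhds (he (e' b))
      (hgrel b) (hfrel (e' b))
    rw [dist_self, eq_comm, mul_eq_zero] at h
    exact ⟨e' b, (dist_eq_zero.mp (h.resolve_left hc.ne')).symm⟩
  refine ⟨Equiv.ofBijective e ⟨hinj, hsurj⟩, ?_, hd⟩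
  have h := key _ _ _ _ _ _ _ _ tendsto_const_nhds tendsto_const_nhds tendsto_const_nhds (he x)
    hb (hfrel x)
  rw [dist_self, eq_comm, mul_eq_zero] at h
  exact (dist_eq_zero.mp (h.resolve_left hc.ne')).symm

/-! ### The quantity `d^R` -/

namespace PointedMetricSpace

theorem AreClose.mono {R ε δ : ℝ} {X : PointedMetricSpace.{u}} {Y : PointedMetricSpace.{v}}
    (h : AreClose R ε X Y) (hle : ε ≤ δ) : AreClose R δ X Y := by
  obtain ⟨Z, _, φ, ψ, h1, h2, h3, h4, h5⟩ := h
  exact ⟨Z, _, φ, ψ, h1, h2, h3.trans_le hle, h4.trans (Metric.thickening_mono hle _),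
    h5.trans (Metric.thickening_mono hle _)⟩

/-- Gluing two pointed spaces at their base points shows that the infimum defining `ghDistAt`
is over a nonempty set, so that it is not a junk value. -/
theorem areClose_of_lt {R ε : ℝ} (X : PointedMetricSpace.{u}) (Y : PointedMetricSpace.{v})
    (hε : 0 < ε) (hR : R < ε) : AreClose R ε X Y := by
  have hΦ : Isometry fun _ : Unit => X.base := isometry_subsingleton
  have hΨ : Isometry fun _ : Unit => Y.base := isometry_subsingleton
  have hglue : Metric.toGlueL hΦ hΨ X.base = Metric.toGlueR hΦ hΨ Y.base :=
    congrFun (Metric.toGlue_commute hΦ hΨ) ()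
  refine ⟨Metric.GlueSpace hΦ hΨ, inferInstance, Metric.toGlueL hΦ hΨ, Metric.toGlueR hΦ hΨ,
    Metric.toGlueL_isometry hΦ hΨ, Metric.toGlueR_isometry hΦ hΨ, ?_, ?_, ?_⟩
  · rwa [hglue, dist_self]
  · rintro _ ⟨a, ha, rfl⟩
    refine Metric.mem_thickening_iff.mpr ⟨_, Set.mem_range_self Y.base, ?_⟩
    rw [← hglue, (Metric.toGlueL_isometry hΦ hΨ).dist_eq]
    exact (Metric.mem_closedBall.mp ha).trans_lt hR
  · rintro _ ⟨b, hb, rfl⟩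
    refine Metric.mem_thickening_iff.mpr ⟨_, Set.mem_range_self X.base, ?_⟩
    rw [hglue, (Metric.toGlueR_isometry hΦ hΨ).dist_eq]
    exact (Metric.mem_closedBall.mp hb).trans_lt hR

theorem ghDistAt_lt_iff {R ε : ℝ} {X : PointedMetricSpace.{u}} {Y : PointedMetricSpace.{v}} :
    ghDistAt R X Y < ε ↔ ∃ δ, 0 < δ ∧ δ < ε ∧ AreClose R δ X Y := by
  unfold ghDistAt
  constructor
  · intro h
    have hne : {δ : ℝ | 0 < δ ∧ AreClose R δ X Y}.Nonempty :=
      ⟨|R| + 1, by positivity, areClose_of_lt X Y (by positivity)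
        ((le_abs_self R).trans_lt (lt_add_one _))⟩
    obtain ⟨δ, ⟨hδ, hc⟩, hlt⟩ := exists_lt_of_csInf_lt hne h
    exact ⟨δ, hδ, hlt, hc⟩
  · rintro ⟨δ, hδ, hlt, hc⟩
    exact lt_of_le_of_lt (csInf_le ⟨0, fun a ha => ha.1.le⟩ ⟨hδ, hc⟩) hlt

end PointedMetricSpace

/-! ### Similarities and blow-ups -/

theorem dist_iterate_of_dist_eq_mul {E : Type*} [MetricSpace E] {f : E → E} {r : ℝ}
    (hf : ∀ a b, dist (f a) (f b) = r * dist a b) (n : ℕ) (a b : E) :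
    dist (f^[n] a) (f^[n] b) = r ^ n * dist a b := by
  induction n with
  | zero => simp
  | succ n ih => rw [Function.iterate_succ_apply', Function.iterate_succ_apply', hf, ih]; ring

/-- A similarity of a finite-dimensional Euclidean space is surjective: up to a homothety it is
an isometric, hence affine, self-map. -/
theorem surjective_of_dist_eq_mul {E : Type*} [NormedAddCommGroup E] [InnerProductSpace ℝ E]
    [FiniteDimensional ℝ E] {f : E → E} {r : ℝ} (hr : 0 < r)
    (hf : ∀ a b, dist (f a) (f b) = r * dist a b) : Function.Surjective f := by
  have hi : Isometry fun a => r⁻¹ • f a := Isometry.of_dist_eq fun a b => by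
    rw [dist_smul₀, hf, Real.norm_of_nonneg (inv_pos.mpr hr).le, inv_mul_cancel_left₀ hr.ne']
  intro b
  have : Inhabited E := ⟨0⟩
  obtain ⟨a, ha⟩ := (hi.affineIsometryOfStrictConvexSpace.toAffineIsometryEquiv rfl).surjective
    (r⁻¹ • b)
  exact ⟨a, smul_right_injective E (inv_ne_zero hr.ne') ha⟩

theorem monotone_iterate_preimage {E : Type*} {f : E → E} {F : Set E} (hF : Set.MapsTo f F F) :
    Monotone fun n : ℕ => f^[n] ⁻¹' F :=
  monotone_nat_of_le_succ fun n q hq => by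
    change f^[n + 1] q ∈ F
    rw [Function.iterate_succ_apply']
    exact hF hq

/-- The blow-up is approximated by the preimages `f⁻ⁿ F`, uniformly on bounded sets. -/
theorem exists_forall_blowUp_approx {E : Type*} [MetricSpace E] [ProperSpace E] {f : E → E}
    {F : Set E} (hF : Set.MapsTo f F F) (x : E) (R : ℝ) {ε : ℝ} (hε : 0 < ε) :
    ∃ N, ∀ n ≥ N, ∀ q ∈ blowUp f F, dist q x ≤ R → ∃ q', f^[n] q' ∈ F ∧ dist q q' < ε := by
  have hmono := monotone_iterate_preimage hF
  obtain ⟨N, hN⟩ := ((isCompact_closedBall x R).inter_right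
      (isClosed_closure (s := ⋃ n : ℕ, f^[n] ⁻¹' F))).elim_directed_cover
    (fun n => Metric.thickening ε (f^[n] ⁻¹' F)) (fun _ => Metric.isOpen_thickening)
    (fun q hq => by
      obtain ⟨q', hq', hd⟩ := Metric.mem_closure_iff.mp hq.2 ε hε
      obtain ⟨n, hn⟩ := Set.mem_iUnion.mp hq'
      exact Set.mem_iUnion.mpr ⟨n, Metric.mem_thickening_iff.mpr ⟨q', hn, hd⟩⟩)
    (directed_of_isDirected_le fun m n hmn => Metric.thickening_subset_of_subset ε (hmono hmn))
  refine ⟨N, fun n hn q hq hR => ?_⟩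
  obtain ⟨q', hq', hd⟩ := Metric.mem_thickening_iff.mp (hN ⟨hR, hq⟩)
  exact ⟨q', hmono hn hq', hd⟩

/-! ### The tangent cone at a fixed point -/

section TangentCone

open PointedMetricSpace

variable {E : Type} [MetricSpace E] [ProperSpace E] {f : E → E} {F : Set E} {r : ℝ} {x : E}

/-- Every dilation of the blow-up is a limit of dilations of `F`. -/
theorem mem_tangentCone_of_isIsometricTo (hr0 : 0 < r) (hr1 : r < 1)
    (hf : ∀ a b, dist (f a) (f b) = r * dist a b) (hsurj : Function.Surjective f)
    (hF : Set.MapsTo f F F) (hfx : f x = x) (hx : x ∈ F) (hZ : x ∈ blowUp f F)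
    {T : PointedMetricSpace.{u}} {c : ℝ} (hc : 0 < c)
    (hT : T.IsIsometricTo ((ofSubset (blowUp f F) x hZ).rescale c hc)) :
    T ∈ tangentCone.{u, 0} (ofSubset F x hx) := by
  obtain ⟨e, he⟩ := hT
  -- the inverse of `e`, with values of type `T`, seen as a map on the subtype `blowUp f F`
  let j : blowUp f F → T := fun z => e.symm z
  have hj : ∀ a b, dist (j a) (j b) = c * dist (a : E) b := fun a b => e.symm.dist_eq a b
  have hjb : j ⟨x, hZ⟩ = T.base := by
    have : e.symm (e T.base) = T.base := e.symm_apply_apply _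
    rw [he] at this
    exact this
  have hjs : Function.Surjective j := e.symm.surjective
  have hjc : Continuous j :=
    (LipschitzWith.of_dist_le_mul (K := ⟨c, hc.le⟩) fun a b => (hj a b).le).continuous
  refine ⟨⟨fun p R => ?_⟩, fun R hR ε hε t₀ => ?_⟩
  · obtain ⟨z, rfl⟩ := hjs p
    have hcl : IsClosed (blowUp f F) := isClosed_closure
    have : ProperSpace (blowUp f F) := ProperSpace.of_isClosed hcl
    have himg : Metric.closedBall (j z) R = j '' Metric.closedBall z (R / c) := by
      ext p
      obtain ⟨z', rfl⟩ := hjs p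
      have hji : Function.Injective j := e.symm.injective
      rw [hji.mem_set_image, Metric.mem_closedBall, Metric.mem_closedBall, hj, le_div_iff₀' hc]
      rfl
    rw [himg]
    exact (isCompact_closedBall z (R / c)).image hjc
  · obtain ⟨N, hN⟩ := exists_forall_blowUp_approx hF x (R / c)
      (ε := ε / 2 / c) (div_pos (half_pos hε.1) hc)
    obtain ⟨M, hM⟩ := pow_unbounded_of_one_lt (t₀ / c) (one_lt_inv₀ hr0 |>.mpr hr1)
    set n := max N M
    have hrn : 0 < r ^ n := pow_pos hr0 n
    refine ⟨c * (r⁻¹) ^ n, by positivity, ?_, ?_⟩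
    · rw [div_lt_iff₀' hc] at hM
      refine hM.trans_le (mul_le_mul_of_nonneg_left ?_ hc.le)
      exact pow_le_pow_right₀ (one_lt_inv₀ hr0 |>.mpr hr1).le (le_max_right _ _)
    choose g hg using hsurj.iterate n
    have hgZ : ∀ u : F, g u ∈ blowUp f F := fun u =>
      subset_closure (Set.mem_iUnion.mpr ⟨n, by simp [hg]⟩)
    have hgd : ∀ a b, dist (g a) (g b) = (r⁻¹) ^ n * dist a b := fun a b => by
      have := dist_iterate_of_dist_eq_mul hf n (g a) (g b)
      rw [hg, hg] at this
      rw [this, inv_pow, inv_mul_cancel_left₀ hrn.ne']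
    have hinj : Function.Injective f^[n] := fun a b hab => by
      have := dist_iterate_of_dist_eq_mul hf n a b
      rw [hab, dist_self, eq_comm, mul_eq_zero] at this
      exact dist_eq_zero.mp (this.resolve_left hrn.ne')
    have hgx : g x = x := hinj ((hg x).trans (Function.iterate_fixed hfx n).symm)
    -- `T` itself is the common space: `F` is mapped onto the copy of `f⁻ⁿ F` in it
    let ψ : F → T := fun u => j ⟨g u, hgZ u⟩
    have hψd : ∀ a b : F, dist (ψ a) (ψ b) = c * (r⁻¹) ^ n * dist a b := fun a b => by
      rw [hj, mul_assoc]
      exact congrArg _ (hgd a b)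
    have hψx : ψ ⟨x, hx⟩ = T.base := by
      rw [← hjb]
      exact congrArg j (Subtype.ext hgx)
    refine ghDistAt_lt_iff.mpr ⟨ε / 2, half_pos hε.1, half_lt_self hε.1, T, T.metric, id, ψ,
      isometry_id, Isometry.of_dist_eq hψd, ?_, ?_, ?_⟩
    · change dist T.base (ψ ⟨x, hx⟩) < _
      rw [hψx, dist_self]
      exact half_pos hε.1
    · rintro _ ⟨p, hp, rfl⟩
      obtain ⟨z, rfl⟩ := hjs p
      rw [Metric.mem_closedBall, ← hjb, hj, ← le_div_iff₀' hc] at hp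
      obtain ⟨q, hq, hd⟩ := hN n (le_max_left _ _) z z.2 hp
      refine Metric.mem_thickening_iff.mpr ⟨_, ⟨⟨_, hq⟩, rfl⟩, ?_⟩
      change dist (j z) (j _) < _
      rw [hj, ← lt_div_iff₀' hc]
      have : g (f^[n] q) = q := hinj (hg _)
      simpa [this] using hd
    · rintro _ ⟨u, -, rfl⟩
      exact Metric.self_subset_thickening (half_pos hε.1) _ ⟨ψ u, rfl⟩

/-- A space in the tangent cone is related to the blow-up, dilated by a factor in `[1, r⁻¹]`, by
a relation of arbitrarily small distortion which is total on large balls: a point `p` is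
related to `q` if some point of `F` is close to both `p` and `f^[n] q`. -/
theorem exists_approx_rel (hr0 : 0 < r) (hr1 : r < 1)
    (hf : ∀ a b, dist (f a) (f b) = r * dist a b) (hsurj : Function.Surjective f)
    (hF : Set.MapsTo f F F) (hfx : f x = x) (hx : x ∈ F) (hZ : x ∈ blowUp f F)
    {T : PointedMetricSpace.{u}} (hT : T ∈ tangentCone.{u, 0} (ofSubset F x hx))
    {R ε : ℝ} (hR : 0 < R) (hε : ε ∈ Set.Ioo (0 : ℝ) 1) :
    ∃ s ∈ Set.Icc 1 r⁻¹, ∃ rel : T → blowUp f F → Prop, rel T.base ⟨x, hZ⟩ ∧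
      (∀ p, dist p T.base ≤ R → ∃ q, rel p q) ∧
      (∀ q : blowUp f F, r⁻¹ * (dist (q : E) x + ε) ≤ R → ∃ p, rel p q) ∧
      ∀ p q p' q', rel p q → rel p' q' →
        |dist p p' - s * dist q q'| ≤ 2 * ε * (1 + r⁻¹) := by
  have hr : 1 < r⁻¹ := (one_lt_inv₀ hr0).mpr hr1
  obtain ⟨N, hN⟩ := exists_forall_blowUp_approx hF x R hε.1
  obtain ⟨t, ht, htN, hclose⟩ := hT.2 R hR ε hε ((r⁻¹) ^ N)
  obtain ⟨δ, -, hδ, hclose⟩ := ghDistAt_lt_iff.mp hclose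
  obtain ⟨W, _, φ, ψ, hφ, hψ, hb, hφR, hψR⟩ := hclose.mono hδ.le
  obtain ⟨n, hn1, hn2⟩ := exists_nat_pow_near ((one_le_pow₀ hr.le).trans htN.le) hr
  have hNn : N ≤ n := by
    by_contra! hlt
    exact absurd (htN.trans hn2) (not_lt.mpr (pow_le_pow_right₀ hr.le hlt))
  have hrn : 0 < r ^ n := pow_pos hr0 n
  have hit := dist_iterate_of_dist_eq_mul hf n
  have hψd : ∀ u u' : F, dist (ψ u) (ψ u') = t * dist (u : E) u' := fun u u' => hψ.dist_eq u u'
  have hs1 : 1 ≤ t * r ^ n := by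
    rwa [inv_pow, inv_le_iff_one_le_mul₀ hrn] at hn1
  have hs2 : t * r ^ n ≤ r⁻¹ := by
    rw [pow_succ, inv_pow, mul_comm, ← div_eq_mul_inv, lt_div_iff₀ hrn] at hn2
    exact hn2.le
  refine ⟨t * r ^ n, ⟨hs1, hs2⟩, fun p q => ∃ u : F, dist (φ p) (ψ u) < ε ∧
    dist (f^[n] q) u < r ^ n * ε, ?_, ?_, ?_, ?_⟩
  · refine ⟨⟨x, hx⟩, hb, ?_⟩
    rw [Function.iterate_fixed hfx, dist_self]
    exact mul_pos hrn hε.1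
  · intro p hp
    obtain ⟨_, ⟨u, rfl⟩, hu⟩ := Metric.mem_thickening_iff.mp (hφR ⟨p, hp, rfl⟩)
    obtain ⟨u, huF⟩ := u
    obtain ⟨q, rfl⟩ := hsurj.iterate n u
    refine ⟨⟨q, subset_closure (Set.mem_iUnion.mpr ⟨n, huF⟩)⟩, ⟨_, huF⟩, hu, ?_⟩
    rw [dist_self]
    exact mul_pos hrn hε.1
  · intro q hq
    have hqR : dist (q : E) x ≤ R := by
      nlinarith [dist_nonneg (x := (q : E)) (y := x), hε.1]
    obtain ⟨q', hq', hd⟩ := hN n hNn q q.2 hqR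
    have hball : dist (ψ ⟨f^[n] q', hq'⟩) (ψ ⟨x, hx⟩) ≤ R := by
      rw [hψd]
      have h1 := hit q' x
      rw [Function.iterate_fixed hfx] at h1
      have h2 : dist q' x ≤ dist (q : E) x + ε := by
        linarith [dist_triangle_left q' x (q : E)]
      rw [h1, ← mul_assoc]
      exact (mul_le_mul hs2 h2 dist_nonneg (zero_le_one.trans hr.le)).trans hq
    obtain ⟨_, ⟨p, rfl⟩, hp⟩ := Metric.mem_thickening_iff.mp
      (hψR ⟨_, (hψ.dist_eq _ _).symm.trans_le hball, rfl⟩)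
    refine ⟨p, ⟨_, hq'⟩, by rwa [dist_comm], ?_⟩
    rw [hit]
    exact mul_lt_mul_of_pos_left hd hrn
  · rintro p q p' q' ⟨u, hu1, hu2⟩ ⟨u', hu1', hu2'⟩
    have h1 : |dist p p' - t * dist (u : E) u'| ≤ 2 * ε := by
      rw [← hφ.dist_eq, ← hψd, ← Real.dist_eq]
      linarith [dist_dist_dist_le (φ p) (φ p') (ψ u) (ψ u')]
    have h2 : |dist (u : E) u' - r ^ n * dist (q : E) q'| ≤ 2 * (r ^ n * ε) := by
      rw [← hit, ← Real.dist_eq, dist_comm]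
      linarith [dist_dist_dist_le (f^[n] q) (f^[n] q') (u : E) u']
    have h3 : |t * dist (u : E) u' - t * r ^ n * dist (q : E) q'| ≤ 2 * ε * r⁻¹ := by
      rw [mul_assoc, ← mul_sub, abs_mul, abs_of_pos ht]
      calc t * |dist (u : E) u' - r ^ n * dist (q : E) q'|
          ≤ t * (2 * (r ^ n * ε)) := mul_le_mul_of_nonneg_left h2 ht.le
        _ = 2 * ε * (t * r ^ n) := by ring
        _ ≤ 2 * ε * r⁻¹ := mul_le_mul_of_nonneg_left hs2 (by linarith [hε.1])
    calc |dist p p' - t * r ^ n * dist (q : E) q'|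
        ≤ |dist p p' - t * dist (u : E) u'|
          + |t * dist (u : E) u' - t * r ^ n * dist (q : E) q'| := abs_sub_le _ _ _
      _ ≤ 2 * ε * (1 + r⁻¹) := by linarith

/-- Every space in the tangent cone is a dilation of the blow-up. -/
theorem exists_isIsometricTo_of_mem_tangentCone (hr0 : 0 < r) (hr1 : r < 1)
    (hf : ∀ a b, dist (f a) (f b) = r * dist a b) (hsurj : Function.Surjective f)
    (hF : Set.MapsTo f F F) (hfx : f x = x) (hx : x ∈ F) (hZ : x ∈ blowUp f F)
    {T : PointedMetricSpace.{u}} (hT : T ∈ tangentCone.{u, 0} (ofSubset F x hx)) :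
    ∃ (c : ℝ) (hc : 0 < c), T.IsIsometricTo ((ofSubset (blowUp f F) x hZ).rescale c hc) := by
  have hε : ∀ k : ℕ, (1 / ((k : ℝ) + 2)) ∈ Set.Ioo (0 : ℝ) 1 := fun k => by
    have hk : (0 : ℝ) ≤ k := k.cast_nonneg
    refine ⟨by positivity, (div_lt_one (by positivity)).mpr (by linarith)⟩
  choose s hs rel hbase hX hY hdist using fun k : ℕ =>
    exists_approx_rel hr0 hr1 hf hsurj hF hfx hx hZ hT (R := k + 1) (by positivity) (hε k)
  let U : Ultrafilter ℕ := hyperfilter ℕ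
  have hU : (U : Filter ℕ) ≤ atTop := Nat.hyperfilter_le_atTop
  obtain ⟨c, hc, hsc⟩ := (isCompact_Icc (a := 1) (b := r⁻¹)).ultrafilter_le_nhds (U.map s)
    (Filter.le_principal_iff.mpr (mem_map.mpr (univ_mem' hs)))
  have hc0 : 0 < c := zero_lt_one.trans_le hc.1
  have hlim : Tendsto (fun k : ℕ => 2 * (1 / ((k : ℝ) + 2)) * (1 + r⁻¹)) atTop (𝓝 0) := by
    have h := tendsto_const_nhds (x := (1 : ℝ)) |>.div_atTop
      (tendsto_atTop_add_const_right atTop (2 : ℝ) tendsto_natCast_atTop_atTop)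
    simpa using (h.const_mul 2).mul_const (1 + r⁻¹)
  have hcl : IsClosed (blowUp f F) := isClosed_closure
  have : ProperSpace (blowUp f F) := ProperSpace.of_isClosed hcl
  have : ProperSpace T := hT.1
  have hev : ∀ M : ℝ, ∀ᶠ k : ℕ in U, M ≤ (k : ℝ) + 1 := fun M =>
    hU ((tendsto_atTop_add_const_right atTop (1 : ℝ)
      tendsto_natCast_atTop_atTop).eventually_ge_atTop M)
  obtain ⟨e, heb, hed⟩ := exists_equiv_of_tendsto_rel U hc0 hsc (hlim.mono_left hU) rel hbase
    (fun p => (hev _).mono fun k hk => hX k p hk)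
    (fun q => (hev (r⁻¹ * (dist (q : E) x + 1))).mono fun k hk => hY k q <| by
      refine le_trans (mul_le_mul_of_nonneg_left ?_ (inv_pos.mpr hr0).le) hk
      linarith [(hε k).2])
    hdist
  exact ⟨c, hc0, ⟨e, Isometry.of_dist_eq fun a b => (hed a b).symm⟩, heb⟩

end TangentCone

theorem mainTheorem5 {d : ℕ} {ι : Type v} [Finite ι]
    (w : ι → EuclideanSpace ℝ (Fin d) → EuclideanSpace ℝ (Fin d))
    (F : Set (EuclideanSpace ℝ (Fin d))) (hF : IsSelfSimilarFractal w F)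
    (i : ι) (x : EuclideanSpace ℝ (Fin d)) (hx : w i x = x) :
    PointedMetricSpace.tangentCone.{u, 0}
        (PointedMetricSpace.ofSubset F x (hF.mem_of_isFixedPt hx)) =
      {T : PointedMetricSpace.{u} | ∃ (c : ℝ) (hc : 0 < c),
        T.IsIsometricTo
          ((PointedMetricSpace.ofSubset (blowUp (w i) F) x
            (mem_blowUp (hF.mem_of_isFixedPt hx))).rescale c hc)} := by
  obtain ⟨r, hr, hw⟩ := hF.similarity i
  have hmaps : Set.MapsTo (w i) F F := fun z hz => by
    rw [hF.eq_iUnion]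
    exact Set.mem_iUnion.mpr ⟨i, z, hz, rfl⟩
  have hsurj := surjective_of_dist_eq_mul hr.1 hw
  have hxF := hF.mem_of_isFixedPt hx
  ext T
  constructor
  · exact exists_isIsometricTo_of_mem_tangentCone hr.1 hr.2 hw hsurj hmaps hx hxF _
  · rintro ⟨c, hc, hT⟩
    exact mem_tangentCone_of_isIsometricTo hr.1 hr.2 hw hsurj hmaps hx hxF _ hc hT
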